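/- Let $M\ge 1$ be an integer. Let $J=(J_0,J_1,\dots)$ and $K=(K_0,K_1,\dots)$ be independent random walks on $\mathbb Z$ with $J_0=K_0=0$, each with i.i.d. steps uniformly distributed on $\{1,2,\dots,M\}$. For $n\ge 0$ let $Z_n=|\{1\le i\le n: J_i-K_i=0\}|$ be the number of visits to $0$ of $J-K$ between times $1$ and $n$, and let $\tau=\inf\{i\ge 1: J_i-K_i=0\}\in\{1,2,\dots\}\cup\{\infty\}$ be the return time of $J-K$ to $0$ (with $c^{-\infty}=0$ for $c>1$). Then there is exactly one real number $c=c_M>1$ with $E(c^{-\tau})=\tfrac12$, and there is a constant $C=C_M>0$, depending only on $M$, such that $$E(2^{Z_n})\sim C\,c_M^{\,n}\qquad(n\to\infty).$$ Moreover, the sequence $E(2^{Z_n})\,c_M^{-n}$, $n\ge 0$, is nondecreasing, the sequence $E(2^{Z_n})$ is log-concave, that is, $E(2^{Z_{n}})^2\ge E(2^{Z_{n-1}})E(2^{Z_{n+1}})$ for all $n\ge 1$, and $c_2=\tfrac43$. -/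

import Mathlib

open MeasureTheory ProbabilityTheory Filter Topology Asymptotics

noncomputable section

/-- The two step sequences: all the variables `ξ i`, `η j` are independent (jointly), and each
is uniformly distributed on the finite set `{1, …, M}`. -/
structure IsUniformStepPair {Ω : Type*} [MeasurableSpace Ω] (P : Measure Ω) (M : ℕ)
    (ξ η : ℕ → Ω → ℤ) : Prop where
  measurable_left : ∀ i, Measurable (ξ i)
  measurable_right : ∀ i, Measurable (η i)
  indep : iIndepFun (Sum.elim ξ η) P
  law_left : ∀ i, P.map (ξ i) = uniformOn (Set.Icc (1 : ℤ) (M : ℤ))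
  law_right : ∀ i, P.map (η i) = uniformOn (Set.Icc (1 : ℤ) (M : ℤ))

/-- The walk started at `0` whose `(i+1)`-st step is `ξ i`. -/
def walk {Ω : Type*} (ξ : ℕ → Ω → ℤ) (n : ℕ) (ω : Ω) : ℤ :=
  ∑ i ∈ Finset.range n, ξ i ω

/-- The number `Z_n` of times `1 ≤ i ≤ n` at which `J_i - K_i = 0`. -/
def zeroVisits {Ω : Type*} (J K : ℕ → Ω → ℤ) (n : ℕ) (ω : Ω) : ℕ :=
  ((Finset.Icc 1 n).filter (fun i => J i ω - K i ω = 0)).card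

/-- The first return time `τ` of `J - K` to `0`, equal to `⊤` if there is no return. -/
def returnTime {Ω : Type*} (J K : ℕ → Ω → ℤ) (ω : Ω) : ℕ∞ :=
  sInf ((fun i : ℕ => (i : ℕ∞)) '' {i : ℕ | 1 ≤ i ∧ J i ω - K i ω = 0})

/-- `c ^ (-t)` for an extended time `t`, with `c ^ (-∞) = 0`. -/
def negPow (c : ℝ) (t : ℕ∞) : ℝ :=
  if t = ⊤ then 0 else (c ^ t.toNat)⁻¹

/-- The expectation `E (2 ^ Z_n)` for the walks with steps `ξ` and `η`. -/
def expTwoPowVisits {Ω : Type*} [MeasurableSpace Ω] (P : Measure Ω) (ξ η : ℕ → Ω → ℤ)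
    (n : ℕ) : ℝ :=
  ∫ ω, (2 : ℝ) ^ zeroVisits (walk ξ) (walk η) n ω ∂P

/-- The expectation `E (c ^ (-τ))` for the walks with steps `ξ` and `η`. -/
def expNegPowReturn {Ω : Type*} [MeasurableSpace Ω] (P : Measure Ω) (ξ η : ℕ → Ω → ℤ)
    (c : ℝ) : ℝ :=
  ∫ ω, negPow c (returnTime (walk ξ) (walk η) ω) ∂P

end

/-! Let `u n` be the probability that the walks meet at time `n`. Since `2 ^ Z` counts sets of
visits, sorting nonempty sets by their first element gives the recursion of `renewalSeq` for the
expectation `W n`, with `u = meetProb M`.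

By Cauchy–Schwarz `u` is antitone and at least a multiple of `1 / (n + 1)`. Divergence of `∑ u n`
yields a unique `c > 1` with `∑_{n ≥ 1} u n c⁻ⁿ = 1`. Antitonicity makes `W` log-concave
(`renewalSeq_mul_le`), and this stands in for the renewal theorem: `W n / c ^ n` is bounded and not
summable, so the nonincreasing ratio `W (n + 1) / W n` never drops below `c`, and `W n / c ^ n`
increases to a finite limit.

The first-return decomposition gives `U - 1 = F U` for the generating functions of meetings and of
`τ`, so `F = 1 / 2` exactly when `U - 1 = 1`. For `M = 2`, `U(z) = (1 - z)^(-1/2)`, which equals `2`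
at `z = 3 / 4`. -/

/-! ### A renewal-type recursion -/

/-- The solution of the recursion `W n = 1 + ∑_{i < n} u (n - i) W i`. -/
noncomputable def renewalSeq (u : ℕ → ℝ) : ℕ → ℝ
  | n => 1 + ∑ i : Fin n, u (n - i) * renewalSeq u i
decreasing_by exact i.2

theorem renewalSeq_eq (u : ℕ → ℝ) (n : ℕ) :
    renewalSeq u n = 1 + ∑ i ∈ Finset.range n, u (n - i) * renewalSeq u i := by
  rw [renewalSeq, Finset.sum_range (fun i => u (n - i) * renewalSeq u i)]

theorem eq_renewalSeq {u W : ℕ → ℝ}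
    (hW : ∀ n, W n = 1 + ∑ i ∈ Finset.range n, u (n - i) * W i) : W = renewalSeq u := by
  funext n
  induction n using Nat.strong_induction_on with
  | _ n ih =>
    rw [hW, renewalSeq_eq]
    congr 1
    exact Finset.sum_congr rfl fun i hi => by rw [ih i (Finset.mem_range.1 hi)]

theorem one_le_renewalSeq {u : ℕ → ℝ} (hu : ∀ n, 0 ≤ u n) (n : ℕ) : 1 ≤ renewalSeq u n := by
  induction n using Nat.strong_induction_on with
  | _ n ih =>
    rw [renewalSeq_eq]
    have : 0 ≤ ∑ i ∈ Finset.range n, u (n - i) * renewalSeq u i :=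
      Finset.sum_nonneg fun i hi =>
        mul_nonneg (hu _) (zero_le_one.trans (ih i (Finset.mem_range.1 hi)))
    linarith

/-- Subtracting consecutive instances of the recursion exposes the differences of `u`, which are
nonnegative when `u` is antitone. -/
theorem renewalSeq_succ (u : ℕ → ℝ) (n : ℕ) :
    renewalSeq u (n + 1) = (1 + u 1) * renewalSeq u n
      - ∑ i ∈ Finset.range n, (u (n - i) - u (n - i + 1)) * renewalSeq u i := by
  rw [renewalSeq_eq u (n + 1), Finset.sum_range_succ]
  have h1 : ∑ i ∈ Finset.range n, u (n + 1 - i) * renewalSeq u i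
      = ∑ i ∈ Finset.range n, u (n - i + 1) * renewalSeq u i :=
    Finset.sum_congr rfl fun i hi => by
      rw [Nat.sub_add_comm (Finset.mem_range.1 hi).le]
  rw [h1]
  simp only [sub_mul, Finset.sum_sub_distrib, Nat.add_sub_cancel_left]
  have h2 := renewalSeq_eq u n
  linarith

/-- Cross-multiplied form of "the ratios `W (n + 1) / W n` are nonincreasing". The strong form, over
all `i ≤ n`, is what the induction needs. -/
theorem renewalSeq_mul_le {u : ℕ → ℝ} (hu : ∀ n, 0 ≤ u n) (hanti : Antitone u) (n : ℕ) :
    ∀ i ≤ n, renewalSeq u (n + 1) * renewalSeq u i ≤ renewalSeq u (i + 1) * renewalSeq u n := by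
  have hpos : ∀ n, 0 < renewalSeq u n := fun n => zero_lt_one.trans_le (one_le_renewalSeq hu n)
  induction n with
  | zero => intro i hi; obtain rfl : i = 0 := by omega
            exact le_rfl
  | succ n ih =>
    have key : renewalSeq u (n + 2) * renewalSeq u n ≤ renewalSeq u (n + 1) ^ 2 := by
      have e1 := renewalSeq_succ u (n + 1)
      have e2 := renewalSeq_succ u n
      -- With the `i = 0` term split off, the remaining terms of the sum at `n + 1` match those at
      -- `n` coefficient by coefficient, with `W (i + 1)` in place of `W i`. The induction
      -- hypothesis compares them, and the split term has the favourable sign.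
      rw [Finset.sum_range_succ'] at e1
      set S1 := ∑ i ∈ Finset.range n,
        (u (n + 1 - (i + 1)) - u (n + 1 - (i + 1) + 1)) * renewalSeq u (i + 1) with hS1
      set S2 := ∑ i ∈ Finset.range n, (u (n - i) - u (n - i + 1)) * renewalSeq u i with hS2
      have h0 : 0 ≤ (u (n + 1 - 0) - u (n + 1 - 0 + 1)) * renewalSeq u 0 :=
        mul_nonneg (sub_nonneg.2 (hanti (Nat.le_succ _))) (hpos 0).le
      have hS : renewalSeq u (n + 1) * S2 ≤ renewalSeq u n * S1 := by
        rw [hS1, hS2, Finset.mul_sum, Finset.mul_sum]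
        refine Finset.sum_le_sum fun i hi => ?_
        rw [Nat.add_sub_add_right]
        have := mul_le_mul_of_nonneg_left (ih i (Finset.mem_range.1 hi).le)
          (sub_nonneg.2 (hanti (Nat.le_succ (n - i))))
        linarith
      have h1 := mul_nonneg (hpos n).le h0
      have e3 : renewalSeq u (n + 1) ^ 2
          = renewalSeq u (n + 1) * ((1 + u 1) * renewalSeq u n - S2) := by rw [← e2, pow_two]
      rw [e1, e3]
      linarith
    intro i hi
    rcases Nat.lt_or_ge n i with h | h
    · obtain rfl : i = n + 1 := by omega
      exact le_rfl
    · have h1 := mul_le_mul_of_nonneg_right key (hpos i).le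
      have h2 := mul_le_mul_of_nonneg_left (ih i h) (hpos (n + 1)).le
      refine le_of_mul_le_mul_right ?_ (hpos n)
      linarith

theorem renewalSeq_log_concave {u : ℕ → ℝ} (hu : ∀ n, 0 ≤ u n) (hanti : Antitone u) (n : ℕ) :
    renewalSeq u n * renewalSeq u (n + 2) ≤ renewalSeq u (n + 1) ^ 2 := by
  have := renewalSeq_mul_le hu hanti (n + 1) n n.le_succ
  rw [pow_two]; linarith

theorem renewalSeq_div_pow_eq (u : ℕ → ℝ) {c : ℝ} (hc : 0 < c) (n : ℕ) :
    renewalSeq u n / c ^ n = c⁻¹ ^ n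
      + ∑ i ∈ Finset.range n, (u (n - i) * c⁻¹ ^ (n - i)) * (renewalSeq u i / c ^ i) := by
  rw [renewalSeq_eq u n, add_div, Finset.sum_div]
  congr 1
  · rw [inv_pow, one_div]
  · refine Finset.sum_congr rfl fun i hi => ?_
    have : c ^ n = c ^ (n - i) * c ^ i := by
      rw [← pow_add, Nat.sub_add_cancel (Finset.mem_range.1 hi).le]
    rw [this, inv_pow]
    field_simp

/-- After scaling by `c ^ n` the weights have total mass `1`, so each new value exceeds the common
bound on the earlier ones by at most the forcing term `c⁻ⁿ`. -/
theorem renewalSeq_div_pow_le {u : ℕ → ℝ} (hu : ∀ n, 0 ≤ u n) {c : ℝ} (hc : 1 < c)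
    (hs : HasSum (fun n => u (n + 1) * c⁻¹ ^ (n + 1)) 1) (n : ℕ) :
    renewalSeq u n / c ^ n ≤ ∑ k ∈ Finset.range (n + 1), c⁻¹ ^ k := by
  have hc0 : 0 < c := by linarith
  have hci : 0 < c⁻¹ := inv_pos.2 hc0
  induction n using Nat.strong_induction_on with
  | _ n ih =>
    rw [renewalSeq_div_pow_eq u hc0 n, Finset.sum_range_succ, add_comm (Finset.sum _ _) (c⁻¹ ^ n)]
    refine add_le_add le_rfl ?_
    set B := ∑ k ∈ Finset.range n, c⁻¹ ^ k
    have hB : 0 ≤ B := Finset.sum_nonneg fun i _ => by positivity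
    calc _ ≤ ∑ i ∈ Finset.range n, (u (n - i) * c⁻¹ ^ (n - i)) * B := by
          refine Finset.sum_le_sum fun i hi => ?_
          have hi := Finset.mem_range.1 hi
          refine mul_le_mul_of_nonneg_left ((ih i hi).trans ?_) (mul_nonneg (hu _) (by positivity))
          exact Finset.sum_le_sum_of_subset_of_nonneg
            (Finset.range_subset_range.2 hi) fun i _ _ => by positivity
      _ = (∑ i ∈ Finset.range n, u (i + 1) * c⁻¹ ^ (i + 1)) * B := by
          rw [← Finset.sum_mul, ← Finset.sum_range_reflect]
          congr 1
          refine Finset.sum_congr rfl fun i hi => ?_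
          have hi := Finset.mem_range.1 hi
          rw [show n - (n - 1 - i) = i + 1 by omega]
      _ ≤ 1 * B := by
          refine mul_le_mul_of_nonneg_right ?_ hB
          exact sum_le_hasSum _ (fun i _ => mul_nonneg (hu _) (by positivity)) hs
      _ = B := one_mul B

/-- Summing the scaled recursion over all `n`, a finite total `V` would satisfy `V = (positive) + 1
* V` by the Cauchy product. -/
theorem not_summable_renewalSeq_div_pow {u : ℕ → ℝ} (hu : ∀ n, 0 ≤ u n) {c : ℝ} (hc : 1 < c)
    (hs : HasSum (fun n => u (n + 1) * c⁻¹ ^ (n + 1)) 1) :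
    ¬ Summable (fun n => renewalSeq u n / c ^ n) := by
  intro hsum
  have hc0 : 0 < c := by linarith
  have hci : 0 < c⁻¹ := inv_pos.2 hc0
  have hpos : ∀ n, 0 < renewalSeq u n := fun n => zero_lt_one.trans_le (one_le_renewalSeq hu n)
  have hprod := (summable_norm_sum_mul_range_of_summable_norm (R := ℝ)
    hs.summable.norm hsum.norm).of_norm
  have htsum := tsum_mul_tsum_eq_tsum_sum_range_of_summable_norm (R := ℝ)
    hs.summable.norm hsum.norm
  have hgeo : Summable (fun n => c⁻¹ ^ n) :=
    summable_geometric_of_lt_one hci.le (inv_lt_one_of_one_lt₀ hc)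
  have e : ∀ n, renewalSeq u (n + 1) / c ^ (n + 1) = c⁻¹ ^ (n + 1)
      + ∑ k ∈ Finset.range (n + 1),
        (u (k + 1) * c⁻¹ ^ (k + 1)) * (renewalSeq u (n - k) / c ^ (n - k)) := by
    intro n
    rw [renewalSeq_div_pow_eq u hc0 (n + 1), ← Finset.sum_range_reflect]
    congr 1
    refine Finset.sum_congr rfl fun i hi => ?_
    have hi := Finset.mem_range.1 hi
    rw [show n + 1 - (n + 1 - 1 - i) = i + 1 by omega, show n + 1 - 1 - i = n - i by omega]
  have h1 := hsum.tsum_eq_zero_add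
  simp_rw [e] at h1
  rw [((summable_nat_add_iff 1).2 hgeo).tsum_add hprod, ← htsum, hs.tsum_eq, one_mul] at h1
  have h2 : 0 ≤ ∑' n, c⁻¹ ^ (n + 1) := tsum_nonneg fun n => by positivity
  have h3 : 0 < renewalSeq u 0 / c ^ 0 := by have := hpos 0; positivity
  linarith

/-- If the ratio fell below `c` once, log-concavity would keep it there, and `W n / c ^ n` would
decay geometrically and be summable. -/
theorem le_renewalSeq_succ_div {u : ℕ → ℝ} (hu : ∀ n, 0 ≤ u n) (hanti : Antitone u) {c : ℝ}
    (hc : 1 < c) (hs : HasSum (fun n => u (n + 1) * c⁻¹ ^ (n + 1)) 1) (n : ℕ) :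
    c * renewalSeq u n ≤ renewalSeq u (n + 1) := by
  by_contra! h
  have hc0 : 0 < c := by linarith
  have hpos : ∀ n, 0 < renewalSeq u n := fun n => zero_lt_one.trans_le (one_le_renewalSeq hu n)
  refine not_summable_renewalSeq_div_pow hu hc hs ?_
  have hr : renewalSeq u (n + 1) / (c * renewalSeq u n) < 1 := by
    rw [div_lt_one (mul_pos hc0 (hpos n))]; exact h
  refine summable_of_ratio_norm_eventually_le hr ?_
  filter_upwards [eventually_ge_atTop n] with m hm
  rw [Real.norm_of_nonneg (div_nonneg (hpos _).le (by positivity)),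
    Real.norm_of_nonneg (div_nonneg (hpos _).le (by positivity)), div_mul_div_comm,
    div_le_div_iff₀ (by positivity) (mul_pos (mul_pos hc0 (hpos n)) (by positivity))]
  have := renewalSeq_mul_le hu hanti m n hm
  calc _ = (renewalSeq u (m + 1) * renewalSeq u n) * c ^ (m + 1) := by ring
    _ ≤ (renewalSeq u (n + 1) * renewalSeq u m) * c ^ (m + 1) := by gcongr

theorem monotone_renewalSeq_div_pow {u : ℕ → ℝ} (hu : ∀ n, 0 ≤ u n) (hanti : Antitone u) {c : ℝ}
    (hc : 1 < c) (hs : HasSum (fun n => u (n + 1) * c⁻¹ ^ (n + 1)) 1) :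
    Monotone (fun n => renewalSeq u n / c ^ n) := by
  have hc0 : 0 < c := by linarith
  refine monotone_nat_of_le_succ fun n => ?_
  rw [div_le_div_iff₀ (by positivity) (by positivity), pow_succ]
  have := mul_le_mul_of_nonneg_right (le_renewalSeq_succ_div hu hanti hc hs n)
    (pow_pos hc0 n).le
  linarith

theorem exists_tendsto_renewalSeq_div_pow {u : ℕ → ℝ} (hu : ∀ n, 0 ≤ u n) (hanti : Antitone u)
    {c : ℝ} (hc : 1 < c) (hs : HasSum (fun n => u (n + 1) * c⁻¹ ^ (n + 1)) 1) :
    ∃ C : ℝ, 0 < C ∧ (fun n => renewalSeq u n) ~[atTop] (fun n => C * c ^ n) := by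
  have hc0 : 0 < c := by linarith
  have hci : 0 < c⁻¹ := inv_pos.2 hc0
  have hmono := monotone_renewalSeq_div_pow hu hanti hc hs
  have hbdd : BddAbove (Set.range fun n => renewalSeq u n / c ^ n) := by
    refine ⟨∑' k, c⁻¹ ^ k, ?_⟩
    rintro _ ⟨n, rfl⟩
    exact (renewalSeq_div_pow_le hu hc hs n).trans
      ((summable_geometric_of_lt_one hci.le (inv_lt_one_of_one_lt₀ hc)).sum_le_tsum _
        fun i _ => by positivity)
  have hlim := tendsto_atTop_ciSup hmono hbdd
  set C := ⨆ n, renewalSeq u n / c ^ n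
  have hC : 0 < C := by
    have h0 := le_ciSup hbdd 0
    have h1 := one_le_renewalSeq hu 0
    simp only [pow_zero, div_one] at h0
    exact lt_of_lt_of_le zero_lt_one (h1.trans h0)
  refine ⟨C, hC, isEquivalent_of_tendsto_one ?_⟩
  have := hlim.div_const C
  rw [div_self hC.ne'] at this
  refine this.congr fun n => ?_
  simp only [Pi.div_apply]
  field_simp

/-! ### The equation determining the growth rate -/

theorem hasSum_shift_mul_pow_unique {u : ℕ → ℝ} (hu : ∀ n, 0 ≤ u n) (h1 : 0 < u 1) {y z : ℝ}
    (hy : 0 ≤ y) (hz : 0 ≤ z) (hsy : HasSum (fun n => u (n + 1) * y ^ (n + 1)) 1)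
    (hsz : HasSum (fun n => u (n + 1) * z ^ (n + 1)) 1) : y = z := by
  have aux : ∀ {y z : ℝ}, 0 ≤ y → HasSum (fun n => u (n + 1) * y ^ (n + 1)) 1 →
      HasSum (fun n => u (n + 1) * z ^ (n + 1)) 1 → ¬ y < z := by
    intro y z hy hsy hsz h
    refine lt_irrefl (1 : ℝ) (hasSum_lt (i := 0) (fun n => ?_) ?_ hsy hsz)
    · exact mul_le_mul_of_nonneg_left (pow_le_pow_left₀ hy h.le _) (hu _)
    · simpa using mul_lt_mul_of_pos_left h h1
  exact le_antisymm (not_lt.1 (aux hz hsz hsy)) (not_lt.1 (aux hy hsy hsz))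

theorem summable_shift_mul_pow {u : ℕ → ℝ} (hu : ∀ n, 0 ≤ u n) (hu1 : ∀ n, u n ≤ 1) {y : ℝ}
    (hy : 0 ≤ y) (hy1 : y < 1) : Summable (fun n => u (n + 1) * y ^ (n + 1)) := by
  refine Summable.of_nonneg_of_le (fun n => mul_nonneg (hu _) (by positivity)) (fun n => ?_)
    ((summable_nat_add_iff 1).2 (summable_geometric_of_lt_one hy hy1))
  exact mul_le_of_le_one_left (by positivity) (hu1 _)

/-- The series may diverge at `1`, so a partial sum exceeding `1` there is moved to some `z < 1` by
continuity of polynomials. The intermediate value theorem then applies on `[0, z]`, where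
convergence is uniform. -/
theorem exists_hasSum_shift_mul_pow {u : ℕ → ℝ} (hu : ∀ n, 0 ≤ u n) (hu1 : ∀ n, u n ≤ 1)
    (hns : ¬ Summable u) :
    ∃ c : ℝ, 1 < c ∧ HasSum (fun n => u (n + 1) * c⁻¹ ^ (n + 1)) 1 := by
  have hns' : ¬ Summable (fun n => u (n + 1)) := fun h => hns ((summable_nat_add_iff 1).1 h)
  have htop := (not_summable_iff_tendsto_nat_atTop_of_nonneg fun n => hu (n + 1)).1 hns'
  obtain ⟨N, hN⟩ := (htop.eventually_gt_atTop 1).exists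
  have hcont : Continuous fun z : ℝ => ∑ i ∈ Finset.range N, u (i + 1) * z ^ (i + 1) := by fun_prop
  have h1 : ∀ᶠ z in 𝓝[<] (1 : ℝ), 1 < ∑ i ∈ Finset.range N, u (i + 1) * z ^ (i + 1) := by
    refine nhdsWithin_le_nhds (hcont.continuousAt.eventually_const_lt ?_)
    simpa using hN
  have h2 : ∀ᶠ z in 𝓝[<] (1 : ℝ), z ∈ Set.Ioo (0 : ℝ) 1 :=
    Ioo_mem_nhdsLT zero_lt_one
  obtain ⟨z, hz, hz0, hz1⟩ := (h1.and h2).exists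
  have hG : ContinuousOn (fun y : ℝ => ∑' n, u (n + 1) * y ^ (n + 1)) (Set.Icc 0 z) := by
    refine continuousOn_tsum (u := fun n => u (n + 1) * z ^ (n + 1)) (fun n => by fun_prop)
      (summable_shift_mul_pow hu hu1 hz0.le hz1) fun n y hy => ?_
    rw [Real.norm_of_nonneg (mul_nonneg (hu _) (pow_nonneg hy.1 _))]
    exact mul_le_mul_of_nonneg_left (pow_le_pow_left₀ hy.1 hy.2 _) (hu _)
  have hGz : 1 < ∑' n, u (n + 1) * z ^ (n + 1) := hz.trans_le
    ((summable_shift_mul_pow hu hu1 hz0.le hz1).sum_le_tsum _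
      fun i _ => mul_nonneg (hu _) (by positivity))
  obtain ⟨y, ⟨hy0, hyz⟩, hy⟩ := intermediate_value_Icc hz0.le hG
    (show (1 : ℝ) ∈ Set.Icc _ _ from ⟨by simp, hGz.le⟩)
  have hy0' : 0 < y := by
    refine lt_of_le_of_ne hy0 fun h => ?_
    subst h
    simp at hy
  have hy1 : y < 1 := hyz.trans_lt hz1
  refine ⟨y⁻¹, (one_lt_inv₀ hy0').2 hy1, ?_⟩
  rw [inv_inv]
  have := (summable_shift_mul_pow hu hu1 hy0 hy1).hasSum
  rwa [show ∑' n, u (n + 1) * y ^ (n + 1) = 1 from hy] at this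

/-! ### The return probabilities -/

/-- The probability that the sum of `n` independent uniform steps in `{1, …, M}` equals `j`. -/
noncomputable def stepSumProb (M : ℕ) : ℕ → ℤ → ℝ
  | 0, j => if j = 0 then 1 else 0
  | n + 1, j => ∑ k ∈ Finset.Icc (1 : ℤ) M, (M : ℝ)⁻¹ * stepSumProb M n (j - k)

/-- The probability that two independent sums of `n` uniform steps in `{1, …, M}` coincide. -/
noncomputable def meetProb (M n : ℕ) : ℝ := ∑' j, stepSumProb M n j ^ 2

theorem mem_Icc_of_stepSumProb_ne_zero {M n : ℕ} {j : ℤ} (h : stepSumProb M n j ≠ 0) :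
    j ∈ Finset.Icc (n : ℤ) (n * M) := by
  induction n generalizing j with
  | zero =>
    rw [stepSumProb] at h
    have : j = 0 := by by_contra h'; exact h (if_neg h')
    simp [this]
  | succ n ih =>
    rw [stepSumProb] at h
    obtain ⟨k, hk, hk'⟩ := Finset.exists_ne_zero_of_sum_ne_zero h
    have := Finset.mem_Icc.1 (ih (right_ne_zero_of_mul hk'))
    rw [Finset.mem_Icc] at hk ⊢
    push_cast
    constructor
    · linarith
    · linarith

theorem hasSum_stepSumProb {M : ℕ} (hM : 1 ≤ M) (n : ℕ) : HasSum (stepSumProb M n) 1 := by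
  have hM' : (M : ℝ) ≠ 0 := by positivity
  induction n with
  | zero => exact hasSum_ite_eq (0 : ℤ) (1 : ℝ)
  | succ n ih =>
    have h := hasSum_sum (s := Finset.Icc (1 : ℤ) M)
      (f := fun k j => (M : ℝ)⁻¹ * stepSumProb M n (j - k)) (a := fun _ => (M : ℝ)⁻¹ * 1)
      fun k _ => ((Equiv.subRight k).hasSum_iff.2 ih).mul_left _
    simpa [stepSumProb, hM', ← funext_iff] using h

theorem summable_stepSumProb_sq (M n : ℕ) : Summable fun j => stepSumProb M n j ^ 2 := by
  refine summable_of_ne_finset_zero (s := Finset.Icc (n : ℤ) (n * M)) fun j hj => ?_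
  by_contra h
  exact hj (mem_Icc_of_stepSumProb_ne_zero fun h' => h (by rw [h']; norm_num))

theorem meetProb_nonneg (M n : ℕ) : 0 ≤ meetProb M n := tsum_nonneg fun _ => sq_nonneg _

theorem meetProb_zero (M : ℕ) : meetProb M 0 = 1 := by
  rw [meetProb, tsum_eq_single 0 fun j hj => by simp [stepSumProb, hj]]
  simp [stepSumProb]

/-- The law after `n + 1` steps averages `M` translates of the law after `n` steps, and averaging
cannot increase the sum of squares. -/
theorem meetProb_succ_le {M : ℕ} (hM : 1 ≤ M) (n : ℕ) : meetProb M (n + 1) ≤ meetProb M n := by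
  have hM' : (0 : ℝ) < M := by exact_mod_cast hM
  have hs (k : ℤ) : HasSum (fun j => stepSumProb M n (j - k) ^ 2) (meetProb M n) :=
    (Equiv.subRight k).hasSum_iff (f := fun j => stepSumProb M n j ^ 2) |>.2
      (summable_stepSumProb_sq M n).hasSum
  have h := hasSum_sum (s := Finset.Icc (1 : ℤ) M)
      (f := fun k j => (M : ℝ)⁻¹ * stepSumProb M n (j - k) ^ 2)
      (a := fun _ => (M : ℝ)⁻¹ * meetProb M n)
      fun k _ => (hs k).mul_left _
  have e : ∑ k ∈ Finset.Icc (1 : ℤ) M, (M : ℝ)⁻¹ * meetProb M n = meetProb M n := by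
    simp [hM'.ne']
  rw [e] at h
  refine hasSum_le (fun j => ?_) (summable_stepSumProb_sq M (n + 1)).hasSum h
  have hsq := sq_sum_le_card_mul_sum_sq (s := Finset.Icc (1 : ℤ) M)
    (f := fun k => stepSumProb M n (j - k))
  have hc : ((Finset.Icc (1 : ℤ) M).card : ℝ) = M := by simp
  rw [hc] at hsq
  have hj : stepSumProb M (n + 1) j
      = (M : ℝ)⁻¹ * ∑ k ∈ Finset.Icc (1 : ℤ) M, stepSumProb M n (j - k) := by
    rw [stepSumProb, Finset.mul_sum]
  rw [hj, ← Finset.mul_sum, mul_pow]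
  refine (mul_le_mul_of_nonneg_left hsq (sq_nonneg _)).trans_eq ?_
  rw [← mul_assoc, pow_two, mul_assoc (M : ℝ)⁻¹, inv_mul_cancel₀ hM'.ne', mul_one]

theorem antitone_meetProb {M : ℕ} (hM : 1 ≤ M) : Antitone (meetProb M) :=
  antitone_nat_of_succ_le (meetProb_succ_le hM)

theorem meetProb_le_one {M : ℕ} (hM : 1 ≤ M) (n : ℕ) : meetProb M n ≤ 1 :=
  (antitone_meetProb hM n.zero_le).trans_eq (meetProb_zero M)

/-- Cauchy–Schwarz for a probability vector supported on at most `M * (n + 1)` points. -/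
theorem inv_le_meetProb {M : ℕ} (hM : 1 ≤ M) (n : ℕ) :
    ((M : ℝ) * ((n + 1 : ℕ) : ℝ))⁻¹ ≤ meetProb M n := by
  have hM' : (1 : ℝ) ≤ M := by exact_mod_cast hM
  set s := Finset.Icc (n : ℤ) (n * M) with hs
  have h1 : ∑ j ∈ s, stepSumProb M n j = 1 := by
    rw [← (hasSum_stepSumProb hM n).tsum_eq]
    refine (tsum_eq_sum fun j hj => ?_).symm
    by_contra h
    exact hj (mem_Icc_of_stepSumProb_ne_zero h)
  have h2 : ∑ j ∈ s, stepSumProb M n j ^ 2 ≤ meetProb M n :=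
    (summable_stepSumProb_sq M n).sum_le_tsum _ fun _ _ => sq_nonneg _
  have h3 := sq_sum_le_card_mul_sum_sq (s := s) (f := stepSumProb M n)
  have h4 : (s.card : ℝ) ≤ M * ((n + 1 : ℕ) : ℝ) := by
    have : s.card ≤ M * (n + 1) := by
      rw [hs, Int.card_Icc, Int.toNat_le]
      push_cast
      have : (1 : ℤ) ≤ M := by exact_mod_cast hM
      nlinarith
    exact_mod_cast this
  rw [h1, one_pow] at h3
  rw [inv_le_iff_one_le_mul₀ (by positivity)]
  calc (1 : ℝ) ≤ s.card * ∑ j ∈ s, stepSumProb M n j ^ 2 := h3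
    _ ≤ (M * ((n + 1 : ℕ) : ℝ)) * meetProb M n :=
      mul_le_mul h4 h2 (Finset.sum_nonneg fun _ _ => sq_nonneg _) (by positivity)
    _ = _ := mul_comm _ _

theorem meetProb_pos {M : ℕ} (hM : 1 ≤ M) (n : ℕ) : 0 < meetProb M n :=
  lt_of_lt_of_le (by positivity) (inv_le_meetProb hM n)

theorem not_summable_meetProb {M : ℕ} (hM : 1 ≤ M) : ¬ Summable (meetProb M) := by
  intro h
  have hM' : (M : ℝ) ≠ 0 := by positivity
  have h1 := (Summable.of_nonneg_of_le (fun n => by positivity) (inv_le_meetProb hM) h).mul_left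
    (M : ℝ)
  refine Real.not_summable_natCast_inv ((summable_nat_add_iff 1).1 (h1.congr fun n => ?_))
  rw [mul_inv, ← mul_assoc, mul_inv_cancel₀ hM', one_mul]

/-! ### Steps in `{1, 2}` -/

/-- Each step is `1` plus a fair bit; the recursion is Pascal's rule. -/
theorem stepSumProb_two (n k : ℕ) : stepSumProb 2 n ((n : ℤ) + k) = n.choose k / 2 ^ n := by
  have hI : Finset.Icc (1 : ℤ) ((2 : ℕ) : ℤ) = {1, 2} := by decide
  induction n generalizing k with
  | zero => cases k with
    | zero => simp [stepSumProb]
    | succ k => simp [stepSumProb]; omega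
  | succ n ih =>
    rw [stepSumProb, hI, Finset.sum_pair (by norm_num)]
    cases k with
    | zero =>
      have h0 : stepSumProb 2 n ((n : ℤ) - 1) = 0 := by
        by_contra h
        have := (Finset.mem_Icc.1 (mem_Icc_of_stepSumProb_ne_zero h)).1
        omega
      have h1 := ih 0
      rw [show ((n + 1 : ℕ) : ℤ) + ((0 : ℕ) : ℤ) - 1 = n + ((0 : ℕ) : ℤ) by push_cast; ring,
        show ((n + 1 : ℕ) : ℤ) + ((0 : ℕ) : ℤ) - 2 = n - 1 by push_cast; ring, h0, h1]
      simp only [Nat.choose_zero_right, Nat.cast_one, mul_zero, add_zero, Nat.cast_ofNat, pow_succ]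
      field_simp
    | succ k =>
      rw [show ((n + 1 : ℕ) : ℤ) + ((k + 1 : ℕ) : ℤ) - 1 = n + ((k + 1 : ℕ) : ℤ) by
          push_cast; ring,
        show ((n + 1 : ℕ) : ℤ) + ((k + 1 : ℕ) : ℤ) - 2 = n + (k : ℤ) by push_cast; ring,
        ih, ih, Nat.choose_succ_succ]
      push_cast
      field_simp
      ring

theorem meetProb_two (n : ℕ) : meetProb 2 n = n.centralBinom / 4 ^ n := by
  have hinj : Function.Injective fun k : ℕ => (n : ℤ) + k := fun a b h => by
    simpa using h
  have hsupp : Function.support (fun j => stepSumProb 2 n j ^ 2) ⊆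
      Set.range fun k : ℕ => (n : ℤ) + k := by
    intro j hj
    have := (Finset.mem_Icc.1 (mem_Icc_of_stepSumProb_ne_zero (ne_zero_pow two_ne_zero hj))).1
    exact ⟨(j - n).toNat, by simp only; omega⟩
  rw [meetProb, ← hinj.tsum_eq hsupp, tsum_eq_sum (s := Finset.range (n + 1))]
  · simp only [stepSumProb_two, div_pow]
    rw [← Finset.sum_div, Nat.centralBinom, ← Nat.sum_range_choose_sq, ← pow_mul, mul_comm n 2,
      pow_mul]
    push_cast
    norm_num
  · intro k hk
    rw [stepSumProb_two, Nat.choose_eq_zero_of_lt (by simpa using hk)]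
    simp

/-- The recurrence for central binomial coefficients says `(1 - 4X) B' = 2B`. Hence `(1 - 4X) B²`
has zero derivative and constant term `1`, so `B²` is the geometric series in `4X`. -/
theorem sum_centralBinom_mul_centralBinom (n : ℕ) :
    ∑ p ∈ Finset.HasAntidiagonal.antidiagonal n, (p.1.centralBinom : ℝ) * p.2.centralBinom
      = 4 ^ n := by
  set B : PowerSeries ℝ := PowerSeries.mk fun n => (n.centralBinom : ℝ) with hB
  have hC : (4 : PowerSeries ℝ) = PowerSeries.C 4 := (map_ofNat PowerSeries.C 4).symm
  have hd : (1 - 4 * PowerSeries.X) * PowerSeries.derivative ℝ B = 2 * B := by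
    ext n
    have e2 : ∀ f : PowerSeries ℝ, PowerSeries.coeff n (2 * f) = 2 * PowerSeries.coeff n f :=
      fun f => by rw [two_mul, map_add, two_mul]
    have e4 : ∀ m, ∀ f : PowerSeries ℝ, PowerSeries.coeff m (4 * f) = 4 * PowerSeries.coeff m f :=
      fun m f => by
        rw [hC, PowerSeries.coeff_C_mul]
    rw [sub_mul, one_mul, mul_assoc, map_sub, e4, e2, PowerSeries.coeff_derivative, hB,
      PowerSeries.coeff_mk, PowerSeries.coeff_mk]
    have hrec := fun m => Nat.succ_mul_centralBinom_succ m
    cases n with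
    | zero => simp [Nat.centralBinom]
    | succ n =>
      rw [PowerSeries.coeff_succ_X_mul, PowerSeries.coeff_derivative, PowerSeries.coeff_mk]
      have h1 : (((n + 1 + 1) * (n + 1 + 1).centralBinom : ℕ) : ℝ)
          = (2 * (2 * (n + 1) + 1) * (n + 1).centralBinom : ℕ) := by exact_mod_cast hrec (n + 1)
      push_cast at h1 ⊢
      linarith
  have hconst : (1 - 4 * PowerSeries.X) * (B * B) = 1 := by
    refine PowerSeries.derivative.ext ?_ ?_
    · rw [Derivation.leibniz, Derivation.leibniz, map_sub, Derivation.leibniz]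
      have h4 : PowerSeries.derivative ℝ (4 : PowerSeries ℝ) = 0 := by
        rw [hC, PowerSeries.derivative_C]
      rw [h4, PowerSeries.derivative_X]
      simp only [smul_eq_mul, Derivation.map_one_eq_zero]
      linear_combination (2 * B) * hd
    · simp [hB]
  rw [← show PowerSeries.coeff n (B * B) = ∑ p ∈ Finset.HasAntidiagonal.antidiagonal n,
    (p.1.centralBinom : ℝ) * p.2.centralBinom by simp [PowerSeries.coeff_mul, hB]]
  induction n with
  | zero => simp [hB]
  | succ n ih =>
    have h := congrArg (PowerSeries.coeff (n + 1)) hconst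
    rw [sub_mul, one_mul, mul_assoc, map_sub,
      hC, PowerSeries.coeff_C_mul,
      PowerSeries.coeff_succ_X_mul, ih, PowerSeries.coeff_one, if_neg n.succ_ne_zero] at h
    rw [pow_succ]
    linarith

/-- The full series squares to `∑ (3 / 4) ^ n = 4`, so it equals `2`; its zeroth term is `1`. -/
theorem hasSum_meetProb_two : HasSum (fun n => meetProb 2 (n + 1) * (4 / 3 : ℝ)⁻¹ ^ (n + 1)) 1 := by
  have hs1 := summable_shift_mul_pow (meetProb_nonneg 2) (meetProb_le_one one_le_two)
    (y := (4 / 3 : ℝ)⁻¹) (by norm_num) (by norm_num)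
  have hs : Summable fun n => meetProb 2 n * (4 / 3 : ℝ)⁻¹ ^ n := (summable_nat_add_iff 1).1 hs1
  have hsq := tsum_mul_tsum_eq_tsum_sum_antidiagonal_of_summable_norm hs.norm hs.norm
  have hterm : ∀ n, ∑ p ∈ Finset.HasAntidiagonal.antidiagonal n,
      meetProb 2 p.1 * (4 / 3 : ℝ)⁻¹ ^ p.1 * (meetProb 2 p.2 * (4 / 3 : ℝ)⁻¹ ^ p.2) = (3 / 4) ^ n := by
    intro n
    have : ∀ p ∈ Finset.HasAntidiagonal.antidiagonal n, meetProb 2 p.1 * (4 / 3 : ℝ)⁻¹ ^ p.1 *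
        (meetProb 2 p.2 * (4 / 3 : ℝ)⁻¹ ^ p.2)
        = ((p.1.centralBinom : ℝ) * p.2.centralBinom) * ((3 / 4) ^ n / 4 ^ n) := by
      intro p hp
      rw [← Finset.HasAntidiagonal.mem_antidiagonal.1 hp, meetProb_two, meetProb_two,
        pow_add, pow_add, inv_div]
      field_simp
    rw [Finset.sum_congr rfl this, ← Finset.sum_mul, sum_centralBinom_mul_centralBinom]
    field_simp
  simp_rw [hterm] at hsq
  rw [tsum_geometric_of_lt_one (by norm_num) (by norm_num)] at hsq
  have h0 : 0 ≤ ∑' n, meetProb 2 n * (4 / 3 : ℝ)⁻¹ ^ n :=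
    tsum_nonneg fun n => mul_nonneg (meetProb_nonneg 2 n) (by positivity)
  have h2 : ∑' n, meetProb 2 n * (4 / 3 : ℝ)⁻¹ ^ n = 2 := by nlinarith
  have h3 := hs.tsum_eq_zero_add
  rw [h2, meetProb_zero] at h3
  have h4 := hs1.hasSum
  rwa [show ∑' n, meetProb 2 (n + 1) * (4 / 3 : ℝ)⁻¹ ^ (n + 1) = 1 by linarith] at h4

/-! ### Integer paths -/

/-- The sum of the first `n` steps of the path with steps `x`. -/
def pathSum (x : ℕ → ℤ) (n : ℕ) : ℤ := ∑ i ∈ Finset.range n, x i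

/-- The number of times `1 ≤ i ≤ n` at which the path with steps `x` is at `0`. -/
def pathZeros (x : ℕ → ℤ) (n : ℕ) : ℕ := ((Finset.Icc 1 n).filter fun i => pathSum x i = 0).card

/-- The indicator of the event that the path with steps `x` is at `0` at time `n`. -/
noncomputable def zeroInd (x : ℕ → ℤ) (n : ℕ) : ℝ := if pathSum x n = 0 then 1 else 0

/-- The indicator of the event that the path with steps `x` first returns to `0` at time
`n + 1`. -/
noncomputable def firstReturnInd (x : ℕ → ℤ) (n : ℕ) : ℝ :=
  if pathSum x (n + 1) = 0 ∧ ∀ j < n, pathSum x (j + 1) ≠ 0 then 1 else 0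

/-- A function of an integer sequence that is determined by the first `k` entries. -/
def DependsOnFirst (k : ℕ) (G : (ℕ → ℤ) → ℝ) : Prop :=
  ∀ x y : ℕ → ℤ, (∀ i < k, x i = y i) → G x = G y

theorem pathSum_congr {x y : ℕ → ℤ} {k n : ℕ} (h : ∀ i < k, x i = y i) (hn : n ≤ k) :
    pathSum x n = pathSum y n :=
  Finset.sum_congr rfl fun i hi => h i ((Finset.mem_range.1 hi).trans_le hn)

theorem pathSum_add (x : ℕ → ℤ) (m n : ℕ) :
    pathSum x (m + n) = pathSum x m + pathSum (fun j => x (m + j)) n :=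
  Finset.sum_range_add x m n

theorem dependsOnFirst_zeroInd (n : ℕ) : DependsOnFirst n fun x => zeroInd x n := by
  intro x y h
  simp only [zeroInd, pathSum_congr h le_rfl]

theorem dependsOnFirst_firstReturnInd (n : ℕ) :
    DependsOnFirst (n + 1) fun x => firstReturnInd x n := by
  intro x y h
  simp only [firstReturnInd]
  congr 1
  rw [pathSum_congr h le_rfl]
  refine propext (and_congr Iff.rfl (forall₂_congr fun j hj => ?_))
  rw [pathSum_congr h (by omega)]

theorem dependsOnFirst_two_pow_pathZeros (n : ℕ) :
    DependsOnFirst n fun x => (2 : ℝ) ^ pathZeros x n := by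
  intro x y h
  simp only [pathZeros]
  congr 2
  refine Finset.filter_congr fun i hi => ?_
  rw [pathSum_congr h (Finset.mem_Icc.1 hi).2]

theorem zeroInd_nonneg (x : ℕ → ℤ) (n : ℕ) : 0 ≤ zeroInd x n := by
  rw [zeroInd]; split_ifs <;> norm_num

theorem zeroInd_le_one (x : ℕ → ℤ) (n : ℕ) : zeroInd x n ≤ 1 := by
  rw [zeroInd]; split_ifs <;> norm_num

theorem firstReturnInd_nonneg (x : ℕ → ℤ) (n : ℕ) : 0 ≤ firstReturnInd x n := by
  rw [firstReturnInd]; split_ifs <;> norm_num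

theorem firstReturnInd_le_one (x : ℕ → ℤ) (n : ℕ) : firstReturnInd x n ≤ 1 := by
  rw [firstReturnInd]; split_ifs <;> norm_num

theorem two_pow_pathZeros_le (x : ℕ → ℤ) (n : ℕ) : (2 : ℝ) ^ pathZeros x n ≤ 2 ^ n := by
  refine pow_le_pow_right₀ one_le_two ((Finset.card_filter_le _ _).trans ?_)
  simp

theorem two_pow_pathZeros_succ (x : ℕ → ℤ) (n : ℕ) :
    (2 : ℝ) ^ pathZeros x (n + 1) = 2 ^ pathZeros x n * (1 + zeroInd x (n + 1)) := by
  have h1 : Finset.Icc 1 (n + 1) = insert (n + 1) (Finset.Icc 1 n) := by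
    ext i; simp only [Finset.mem_Icc, Finset.mem_insert]; omega
  rw [pathZeros, pathZeros, zeroInd, h1, Finset.filter_insert]
  split_ifs with h
  · rw [Finset.card_insert_of_notMem (by simp), pow_succ]
    norm_num
  · simp

/-- Sets of visit times: the empty set gives `1`, and the others are sorted by their least element
`i + 1`, with the rest chosen freely among later visits. -/
theorem two_pow_pathZeros_eq (x : ℕ → ℤ) (n : ℕ) :
    (2 : ℝ) ^ pathZeros x n = 1 + ∑ i ∈ Finset.range n,
      zeroInd x (i + 1) * 2 ^ pathZeros (fun j => x (i + 1 + j)) (n - (i + 1)) := by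
  induction n with
  | zero => simp [pathZeros]
  | succ n ih =>
    have hterm : ∀ i ∈ Finset.range n,
        zeroInd x (i + 1) * (2 : ℝ) ^ pathZeros (fun j => x (i + 1 + j)) (n + 1 - (i + 1))
        = (zeroInd x (i + 1) * 2 ^ pathZeros (fun j => x (i + 1 + j)) (n - (i + 1)))
          * (1 + zeroInd x (n + 1)) := by
      intro i hi
      have hi := Finset.mem_range.1 hi
      rw [show n + 1 - (i + 1) = n - (i + 1) + 1 by omega, two_pow_pathZeros_succ, mul_assoc]
      -- From a zero at time `i + 1`, the shifted path has the same later zeros; otherwise the term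
      -- vanishes.
      by_cases h0 : pathSum x (i + 1) = 0
      · have : zeroInd (fun j => x (i + 1 + j)) (n - (i + 1) + 1) = zeroInd x (n + 1) := by
          have h := pathSum_add x (i + 1) (n - (i + 1) + 1)
          rw [h0, zero_add, show i + 1 + (n - (i + 1) + 1) = n + 1 by omega] at h
          rw [zeroInd, zeroInd, h]
        rw [this]
      · simp [zeroInd, h0]
    rw [two_pow_pathZeros_succ, Finset.sum_range_succ, Finset.sum_congr rfl hterm,
      ← Finset.sum_mul, Nat.sub_self, ih]
    simp [pathZeros]
    ring

/-- Only the term of the first return can be nonzero. -/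
theorem zeroInd_succ_eq (x : ℕ → ℤ) (n : ℕ) :
    zeroInd x (n + 1) = ∑ i ∈ Finset.range (n + 1),
      firstReturnInd x i * zeroInd (fun j => x (i + 1 + j)) (n - i) := by
  by_cases h : ∃ i, i ≤ n ∧ pathSum x (i + 1) = 0
  · have hN := Nat.find_spec h
    have hmin : ∀ j < Nat.find h, pathSum x (j + 1) ≠ 0 := fun j hj h0 =>
      Nat.find_min h hj ⟨hj.le.trans hN.1, h0⟩
    set N := Nat.find h
    rw [Finset.sum_eq_single_of_mem N (Finset.mem_range.2 (by omega))]
    · have h1 := pathSum_add x (N + 1) (n - N)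
      rw [hN.2, zero_add, show N + 1 + (n - N) = n + 1 by omega] at h1
      rw [firstReturnInd, if_pos ⟨hN.2, hmin⟩, one_mul, zeroInd, zeroInd, h1]
    · intro i hi hne
      rw [firstReturnInd, if_neg, zero_mul]
      rintro ⟨h0, h1⟩
      rcases lt_or_gt_of_ne hne with h2 | h2
      · exact hmin i h2 h0
      · exact h1 N h2 hN.2
  · push Not at h
    rw [Finset.sum_eq_zero, zeroInd, if_neg (h n le_rfl)]
    intro i hi
    rw [firstReturnInd, if_neg, zero_mul]
    exact fun h0 => h i (by simpa [Nat.lt_succ_iff] using hi) h0.1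

/-! ### Visits and return time of the two walks in terms of the difference path -/

section Walks

variable {Ω : Type*} (ξ η : ℕ → Ω → ℤ)

/-- The steps of the difference of the walks with steps `ξ` and `η`. -/
def diffStep (ω : Ω) (i : ℕ) : ℤ := ξ i ω - η i ω

theorem walk_sub_walk (n : ℕ) (ω : Ω) :
    walk ξ n ω - walk η n ω = pathSum (diffStep ξ η ω) n :=
  (Finset.sum_sub_distrib _ _).symm

theorem zeroVisits_eq (n : ℕ) (ω : Ω) :
    zeroVisits (walk ξ) (walk η) n ω = pathZeros (diffStep ξ η ω) n := by
  simp only [zeroVisits, walk_sub_walk, pathZeros]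

/-- At most one term, that of index `τ - 1`, is nonzero. If there is no return all vanish, in
agreement with `c ^ (-∞) = 0`. -/
theorem negPow_returnTime (c : ℝ) (ω : Ω) :
    negPow c (returnTime (walk ξ) (walk η) ω)
      = ∑' n, firstReturnInd (diffStep ξ η ω) n * c⁻¹ ^ (n + 1) := by
  simp only [returnTime, walk_sub_walk]
  set x := diffStep ξ η ω
  by_cases h : ∃ n, pathSum x (n + 1) = 0
  · have hN := Nat.find_spec h
    have hmin : ∀ j < Nat.find h, pathSum x (j + 1) ≠ 0 := fun j hj => Nat.find_min h hj
    set N := Nat.find h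
    have hleast : IsLeast ((fun i : ℕ => (i : ℕ∞)) '' {i : ℕ | 1 ≤ i ∧ pathSum x i = 0})
        ((N + 1 : ℕ) : ℕ∞) := by
      refine ⟨⟨N + 1, ⟨by omega, hN⟩, rfl⟩, ?_⟩
      rintro _ ⟨i, ⟨hi, h0⟩, rfl⟩
      refine Nat.cast_le.2 ?_
      by_contra hlt
      refine hmin (i - 1) (by omega) ?_
      rwa [Nat.sub_add_cancel hi]
    rw [hleast.csInf_eq, negPow, if_neg (ENat.natCast_ne_top _), ENat.toNat_natCast,
      tsum_eq_single N, firstReturnInd, if_pos ⟨hN, hmin⟩, one_mul, inv_pow]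
    intro i hne
    rw [firstReturnInd, if_neg, zero_mul]
    rintro ⟨h0, h1⟩
    rcases lt_or_gt_of_ne hne with h2 | h2
    · exact hmin i h2 h0
    · exact h1 N h2 hN
  · push Not at h
    have hempty : {i : ℕ | 1 ≤ i ∧ pathSum x i = 0} = ∅ := by
      refine Set.eq_empty_of_forall_notMem fun i hi => h (i - 1) ?_
      rw [Nat.sub_add_cancel hi.1]
      exact hi.2
    rw [hempty, Set.image_empty, sInf_empty, negPow, if_pos rfl]
    refine ((tsum_congr fun n => ?_).trans tsum_zero).symm
    rw [firstReturnInd, if_neg fun h0 => h n h0.1, zero_mul]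

end Walks

/-! ### The law of the difference of the walks -/

theorem hasSum_real_eq_of_indepFun {Ω : Type*} [MeasurableSpace Ω] {P : Measure Ω}
    [IsProbabilityMeasure P] {A B : Ω → ℤ} (hA : Measurable A) (hB : Measurable B)
    (hAB : IndepFun A B P) (g : ℤ → ℤ) :
    HasSum (fun k => P.real {ω | A ω = k} * P.real {ω | B ω = g k})
      (P.real {ω | B ω = g (A ω)}) := by
  have hunion : {ω | B ω = g (A ω)} = ⋃ k, (A ⁻¹' {k} ∩ B ⁻¹' {g k}) := by
    ext ω; simp
  have hmeas : P {ω | B ω = g (A ω)} = ∑' k, P (A ⁻¹' {k} ∩ B ⁻¹' {g k}) := by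
    rw [hunion, measure_iUnion]
    · intro i j hij
      refine Set.disjoint_left.2 fun ω h1 h2 => hij ?_
      exact h1.1.symm.trans h2.1
    · exact fun k => (hA (measurableSet_singleton _)).inter (hB (measurableSet_singleton _))
  have h := ENNReal.hasSum_toReal (f := fun k => P (A ⁻¹' {k} ∩ B ⁻¹' {g k}))
    (by rw [← hmeas]; exact measure_ne_top _ _)
  have hE : ∀ k, (P (A ⁻¹' {k} ∩ B ⁻¹' {g k})).toReal
      = P.real {ω | A ω = k} * P.real {ω | B ω = g k} := fun k => by
    rw [hAB.measure_inter_preimage_eq_mul _ _ (measurableSet_singleton _)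
      (measurableSet_singleton _), ENNReal.toReal_mul]
    rfl
  rw [← ENNReal.tsum_toReal_eq (fun k => measure_ne_top _ _), ← hmeas] at h
  simp_rw [hE] at h
  exact h

theorem real_eq_of_map_eq_uniformOn {Ω : Type*} [MeasurableSpace Ω] {P : Measure Ω} {M : ℕ}
    {A : Ω → ℤ} (hA : Measurable A)
    (hlaw : P.map A = uniformOn (Set.Icc (1 : ℤ) (M : ℤ))) (k : ℤ) :
    P.real {ω | A ω = k} = if k ∈ Finset.Icc (1 : ℤ) M then (M : ℝ)⁻¹ else 0 := by
  classical
  have h : P {ω | A ω = k} = uniformOn (Set.Icc (1 : ℤ) (M : ℤ)) {k} := by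
    rw [← hlaw, Measure.map_apply hA (measurableSet_singleton _)]; rfl
  rw [← Finset.coe_Icc, ← Finset.coe_singleton, uniformOn_apply_finset] at h
  rw [Measure.real, h]
  split_ifs with hk
  · rw [Finset.inter_singleton_of_mem hk]
    simp
  · rw [Finset.inter_singleton_of_notMem hk]
    simp

theorem real_walk_eq {Ω : Type*} [MeasurableSpace Ω] {P : Measure Ω} [IsProbabilityMeasure P]
    {M : ℕ} {ξ : ℕ → Ω → ℤ} (hmeas : ∀ i, Measurable (ξ i)) (hind : iIndepFun ξ P)
    (hlaw : ∀ i, P.map (ξ i) = uniformOn (Set.Icc (1 : ℤ) (M : ℤ))) (n : ℕ) (j : ℤ) :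
    P.real {ω | walk ξ n ω = j} = stepSumProb M n j := by
  have hwm : ∀ n, Measurable (walk ξ n) := fun n => by
    unfold walk
    exact Finset.measurable_fun_sum _ fun i _ => hmeas i
  induction n generalizing j with
  | zero =>
    rcases eq_or_ne j 0 with rfl | hj
    · simp [walk, stepSumProb]
    · simp [walk, stepSumProb, hj, hj.symm]
  | succ n ih =>
    have hI : IndepFun (ξ n) (walk ξ n) P := by
      have h1 := hind.indepFun_finset {n} (Finset.range n) (by simp) hmeas
      have hφ : Measurable fun y : ({n} : Finset ℕ) → ℤ => y ⟨n, Finset.mem_singleton_self n⟩ :=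
        measurable_pi_apply _
      have h2 := h1.comp (ψ := fun y => ∑ i : Finset.range n, y i) hφ (by fun_prop)
      have h3 : walk ξ n = (fun y : Finset.range n → ℤ => ∑ i : Finset.range n, y i) ∘
          fun ω (i : Finset.range n) => ξ i ω := by
        funext ω
        exact (Finset.sum_coe_sort (Finset.range n) fun i => ξ i ω).symm
      rw [h3]
      exact h2
    have h := hasSum_real_eq_of_indepFun (hmeas n) (hwm n) hI fun k => j - k
    have e : {ω | walk ξ n ω = j - ξ n ω} = {ω | walk ξ (n + 1) ω = j} := by
      ext ω
      simp only [walk, Finset.sum_range_succ, Set.mem_ofPred_eq, eq_sub_iff_add_eq]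
    rw [e] at h
    rw [← h.tsum_eq, tsum_eq_sum (s := Finset.Icc (1 : ℤ) M), stepSumProb]
    · refine Finset.sum_congr rfl fun k hk => ?_
      rw [real_eq_of_map_eq_uniformOn (hmeas n) (hlaw n), if_pos hk, ih]
    · intro k hk
      rw [real_eq_of_map_eq_uniformOn (hmeas n) (hlaw n), if_neg hk, zero_mul]

namespace IsUniformStepPair

variable {Ω : Type*} [MeasurableSpace Ω] {P : Measure Ω} {M : ℕ} {ξ η : ℕ → Ω → ℤ}

theorem measurable_elim (h : IsUniformStepPair P M ξ η) (i : ℕ ⊕ ℕ) :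
    Measurable (Sum.elim ξ η i) := by
  cases i with
  | inl i => exact h.measurable_left i
  | inr i => exact h.measurable_right i

/-- `H` factors through `m` integer coordinates, a countable space on which every function is
measurable. The padding by `0` is never seen. -/
theorem measurable_comp_diffStep (h : IsUniformStepPair P M ξ η) {m : ℕ} {H : (ℕ → ℤ) → ℝ}
    (hH : DependsOnFirst m H) (k : ℕ) :
    Measurable fun ω => H (fun j => diffStep ξ η ω (k + j)) := by
  let φ : (Fin m → ℤ) → ℝ := fun y => H fun j => if hj : j < m then y ⟨j, hj⟩ else 0
  have e : (fun ω => H (fun j => diffStep ξ η ω (k + j)))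
      = φ ∘ fun ω (j : Fin m) => diffStep ξ η ω (k + j) := by
    funext ω
    refine hH _ _ fun j hj => ?_
    simp [hj]
  rw [e]
  refine (measurable_of_countable φ).comp (measurable_pi_lambda _ fun j => ?_)
  exact (h.measurable_left _).sub (h.measurable_right _)

theorem map_shift (h : IsUniformStepPair P M ξ η) (k m : ℕ) :
    P.map (fun ω (i : Fin m ⊕ Fin m) =>
        Sum.elim ξ η (Sum.map (fun j : Fin m => k + j) (fun j : Fin m => k + j) i) ω)
      = Measure.pi fun _ => uniformOn (Set.Icc (1 : ℤ) (M : ℤ)) := by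
  have hinj : Function.Injective fun j : Fin m => k + (j : ℕ) := fun a b hab =>
    Fin.ext (Nat.add_left_cancel hab)
  have h1 := h.indep.precomp (hinj.sumMap hinj)
  rw [h1.map_fun_eq_pi_map fun i => (h.measurable_elim _).aemeasurable]
  congr 1
  funext i
  cases i with
  | inl i => exact h.law_left _
  | inr i => exact h.law_right _

theorem integral_shift (h : IsUniformStepPair P M ξ η) {m : ℕ} {H : (ℕ → ℤ) → ℝ}
    (hH : DependsOnFirst m H) (k : ℕ) :
    ∫ ω, H (fun j => diffStep ξ η ω (k + j)) ∂P = ∫ ω, H (diffStep ξ η ω) ∂P := by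
  let φ : (Fin m ⊕ Fin m → ℤ) → ℝ := fun y => H fun j =>
    if hj : j < m then y (Sum.inl ⟨j, hj⟩) - y (Sum.inr ⟨j, hj⟩) else 0
  have key : ∀ k, ∫ ω, H (fun j => diffStep ξ η ω (k + j)) ∂P
      = ∫ y, φ y ∂(Measure.pi fun _ : Fin m ⊕ Fin m => uniformOn (Set.Icc (1 : ℤ) (M : ℤ))) := by
    intro k
    rw [← h.map_shift k m, integral_map]
    · refine integral_congr_ae (Eventually.of_forall fun ω => hH _ _ fun j hj => ?_)
      simp [hj, diffStep]
    · exact (measurable_pi_lambda _ fun i => h.measurable_elim _).aemeasurable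
    · exact (measurable_of_countable φ).aestronglyMeasurable
  rw [key k, ← key 0]
  simp

/-- Markov property at time `k`: the factors use disjoint blocks of steps, and the law of a block
does not depend on its starting point. -/
theorem integral_mul_shift (h : IsUniformStepPair P M ξ η) {k m : ℕ} {G H : (ℕ → ℤ) → ℝ}
    (hG : DependsOnFirst k G) (hH : DependsOnFirst m H) :
    ∫ ω, G (diffStep ξ η ω) * H (fun j => diffStep ξ η ω (k + j)) ∂P
      = (∫ ω, G (diffStep ξ η ω) ∂P) * ∫ ω, H (diffStep ξ η ω) ∂P := by
  classical
  let S : Finset (ℕ ⊕ ℕ) := (Finset.range k).disjSum (Finset.range k)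
  let T : Finset (ℕ ⊕ ℕ) := (Finset.Ico k (k + m)).disjSum (Finset.Ico k (k + m))
  have hST : Disjoint S T := by
    refine Finset.disjoint_left.2 fun a ha hb => ?_
    cases a <;> simp [S, T] at ha hb <;> omega
  let φ : (S → ℤ) → ℝ := fun y => G fun i => if hi : i < k then
    y ⟨Sum.inl i, by simpa [S] using hi⟩ - y ⟨Sum.inr i, by simpa [S] using hi⟩ else 0
  let ψ : (T → ℤ) → ℝ := fun y => H fun j => if hj : j < m then
    y ⟨Sum.inl (k + j), by simpa [T] using hj⟩ - y ⟨Sum.inr (k + j), by simpa [T] using hj⟩ else 0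
  have hind := (h.indep.indepFun_finset S T hST h.measurable_elim).comp
    (measurable_of_countable φ) (measurable_of_countable ψ)
  have hφ : (φ ∘ fun ω (i : S) => Sum.elim ξ η i ω) = fun ω => G (diffStep ξ η ω) := by
    funext ω
    refine hG _ _ fun i hi => ?_
    simp [hi, diffStep]
  have hψ : (ψ ∘ fun ω (i : T) => Sum.elim ξ η i ω)
      = fun ω => H (fun j => diffStep ξ η ω (k + j)) := by
    funext ω
    refine hH _ _ fun j hj => ?_
    simp [hj, diffStep]
  rw [hφ, hψ] at hind
  rw [hind.integral_fun_mul_eq_mul_integral, h.integral_shift hH]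
  · simpa using (h.measurable_comp_diffStep hG 0).aestronglyMeasurable
  · exact (h.measurable_comp_diffStep hH k).aestronglyMeasurable

variable [IsProbabilityMeasure P]

theorem real_diff_eq_zero (h : IsUniformStepPair P M ξ η) (n : ℕ) :
    P.real {ω | pathSum (diffStep ξ η ω) n = 0} = meetProb M n := by
  have hl : iIndepFun ξ P := h.indep.precomp (g := Sum.inl) Sum.inl_injective
  have hr : iIndepFun η P := h.indep.precomp (g := Sum.inr) Sum.inr_injective
  have hwm : ∀ {ζ : ℕ → Ω → ℤ}, (∀ i, Measurable (ζ i)) → Measurable (walk ζ n) := fun hζ => by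
    unfold walk
    exact Finset.measurable_fun_sum _ fun i _ => hζ i
  have hI : IndepFun (walk ξ n) (walk η n) P := by
    classical
    have h1 := h.indep.indepFun_finset ((Finset.range n).map ⟨Sum.inl, Sum.inl_injective⟩)
      ((Finset.range n).map ⟨Sum.inr, Sum.inr_injective⟩)
      (Finset.disjoint_left.2 fun a ha hb => by
        obtain ⟨i, _, rfl⟩ := Finset.mem_map.1 ha
        obtain ⟨j, _, hj⟩ := Finset.mem_map.1 hb
        exact Sum.inr_ne_inl hj) h.measurable_elim
    have h2 := h1.comp (φ := fun y => ∑ i, y i) (ψ := fun y => ∑ i, y i)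
      (by fun_prop) (by fun_prop)
    convert h2 using 1
    · funext ω
      refine Eq.trans ?_ (Finset.sum_coe_sort
        ((Finset.range n).map ⟨Sum.inl, Sum.inl_injective⟩) fun i => Sum.elim ξ η i ω).symm
      rw [Finset.sum_map]
      rfl
    · funext ω
      refine Eq.trans ?_ (Finset.sum_coe_sort
        ((Finset.range n).map ⟨Sum.inr, Sum.inr_injective⟩) fun i => Sum.elim ξ η i ω).symm
      rw [Finset.sum_map]
      rfl
  have hsum := hasSum_real_eq_of_indepFun (hwm h.measurable_left) (hwm h.measurable_right) hI id
  have e : {ω | walk η n ω = id (walk ξ n ω)} = {ω | pathSum (diffStep ξ η ω) n = 0} := by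
    ext ω
    simp only [Set.mem_ofPred_eq, ← walk_sub_walk, id, sub_eq_zero, eq_comm]
  rw [e] at hsum
  rw [← hsum.tsum_eq, meetProb]
  refine tsum_congr fun k => ?_
  rw [real_walk_eq h.measurable_left hl h.law_left, id,
    real_walk_eq h.measurable_right hr h.law_right, pow_two]

theorem integral_zeroInd (h : IsUniformStepPair P M ξ η) (n : ℕ) :
    ∫ ω, zeroInd (diffStep ξ η ω) n ∂P = meetProb M n := by
  have hm : MeasurableSet {ω | pathSum (diffStep ξ η ω) n = 0} := by
    have := h.measurable_comp_diffStep (dependsOnFirst_zeroInd n) 0 (measurableSet_singleton 1)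
    convert this using 1
    ext ω
    simp [zeroInd]
  rw [← h.real_diff_eq_zero n, ← integral_indicator_one hm]
  refine integral_congr_ae (Eventually.of_forall fun ω => ?_)
  simp [zeroInd, Set.indicator_apply]

theorem integrable_comp_diffStep (h : IsUniformStepPair P M ξ η) {m : ℕ} {H : (ℕ → ℤ) → ℝ}
    (hH : DependsOnFirst m H) {B : ℝ} (h0 : ∀ x, 0 ≤ H x) (hB : ∀ x, H x ≤ B) (k : ℕ) :
    Integrable (fun ω => H (fun j => diffStep ξ η ω (k + j))) P :=
  Integrable.of_bound (h.measurable_comp_diffStep hH k).aestronglyMeasurable B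
    (Eventually.of_forall fun ω => by rw [Real.norm_of_nonneg (h0 _)]; exact hB _)

theorem expTwoPowVisits_eq (h : IsUniformStepPair P M ξ η) :
    expTwoPowVisits P ξ η = renewalSeq (meetProb M) := by
  have hV : ∀ n, expTwoPowVisits P ξ η n = ∫ ω, (2 : ℝ) ^ pathZeros (diffStep ξ η ω) n ∂P :=
    fun n => by simp only [expTwoPowVisits, zeroVisits_eq]
  refine eq_renewalSeq fun n => ?_
  have hint : ∀ i ∈ Finset.range n, Integrable (fun ω => zeroInd (diffStep ξ η ω) (i + 1) *
      2 ^ pathZeros (fun j => diffStep ξ η ω (i + 1 + j)) (n - (i + 1))) P := by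
    intro i _
    refine (h.integrable_comp_diffStep (dependsOnFirst_two_pow_pathZeros _)
      (fun x => by positivity) (two_pow_pathZeros_le · _) (i + 1)).bdd_mul (c := 1) ?_ ?_
    · simpa using
        (h.measurable_comp_diffStep (dependsOnFirst_zeroInd (i + 1)) 0).aestronglyMeasurable
    · refine Eventually.of_forall fun ω => ?_
      rw [Real.norm_of_nonneg (zeroInd_nonneg _ _)]
      exact zeroInd_le_one _ _
  rw [hV n]
  simp_rw [two_pow_pathZeros_eq _ n]
  -- The sum is reversed because the path identity is indexed by the chosen visit time, the
  -- recursion by the time remaining after it.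
  rw [integral_add (integrable_const _) (integrable_finsetSum _ hint),
    integral_finsetSum _ hint, ← Finset.sum_range_reflect]
  simp only [integral_const, probReal_univ, smul_eq_mul, mul_one]
  congr 1
  refine Finset.sum_congr rfl fun i hi => ?_
  have hi := Finset.mem_range.1 hi
  rw [h.integral_mul_shift (dependsOnFirst_zeroInd _) (dependsOnFirst_two_pow_pathZeros _),
    h.integral_zeroInd, ← hV, show n - 1 - i + 1 = n - i by omega, Nat.sub_sub_self hi.le]

theorem meetProb_succ_eq (h : IsUniformStepPair P M ξ η) (n : ℕ) :
    meetProb M (n + 1) = ∑ i ∈ Finset.range (n + 1),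
      (∫ ω, firstReturnInd (diffStep ξ η ω) i ∂P) * meetProb M (n - i) := by
  have hint : ∀ i ∈ Finset.range (n + 1), Integrable (fun ω => firstReturnInd (diffStep ξ η ω) i *
      zeroInd (fun j => diffStep ξ η ω (i + 1 + j)) (n - i)) P := by
    intro i _
    refine (h.integrable_comp_diffStep (dependsOnFirst_zeroInd _)
      (zeroInd_nonneg · _) (zeroInd_le_one · _) (i + 1)).bdd_mul (c := 1) ?_ ?_
    · simpa using
        (h.measurable_comp_diffStep (dependsOnFirst_firstReturnInd i) 0).aestronglyMeasurable
    · refine Eventually.of_forall fun ω => ?_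
      rw [Real.norm_of_nonneg (firstReturnInd_nonneg _ _)]
      exact firstReturnInd_le_one _ _
  rw [← h.integral_zeroInd]
  simp_rw [zeroInd_succ_eq]
  rw [integral_finsetSum _ hint]
  refine Finset.sum_congr rfl fun i _ => ?_
  rw [h.integral_mul_shift (dependsOnFirst_firstReturnInd _) (dependsOnFirst_zeroInd _),
    h.integral_zeroInd]

theorem hasSum_expNegPowReturn (h : IsUniformStepPair P M ξ η) {c : ℝ} (hc : 1 < c) :
    HasSum (fun n => (∫ ω, firstReturnInd (diffStep ξ η ω) n ∂P) * c⁻¹ ^ (n + 1))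
      (expNegPowReturn P ξ η c) := by
  have hci : 0 < c⁻¹ := inv_pos.2 (by linarith)
  have hint : ∀ n, Integrable (fun ω => firstReturnInd (diffStep ξ η ω) n) P := fun n => by
    simpa using h.integrable_comp_diffStep (dependsOnFirst_firstReturnInd n)
      (firstReturnInd_nonneg · _) (firstReturnInd_le_one · _) 0
  have hsum := hasSum_integral_of_summable_integral_norm
    (F := fun n ω => firstReturnInd (diffStep ξ η ω) n * c⁻¹ ^ (n + 1))
    (fun n => (hint n).mul_const _) ?_
  · simp_rw [integral_mul_const] at hsum
    simpa only [expNegPowReturn, negPow_returnTime] using hsum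
  · refine Summable.of_nonneg_of_le (fun n => integral_nonneg fun ω => norm_nonneg _) (fun n => ?_)
      ((summable_nat_add_iff 1).2
        (summable_geometric_of_lt_one hci.le (inv_lt_one_of_one_lt₀ hc)))
    have h1 := integral_mono (μ := P) ((hint n).mul_const (c⁻¹ ^ (n + 1))).norm
      (integrable_const (c⁻¹ ^ (n + 1))) fun ω => by
        simp only
        rw [Real.norm_of_nonneg (mul_nonneg (firstReturnInd_nonneg _ _) (by positivity))]
        exact mul_le_of_le_one_left (by positivity) (firstReturnInd_le_one _ _)
    simpa using h1

/-- With `F = E (x ^ (-τ))` and `S` the series on the right, the renewal equation and the Cauchy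
product give `F * (1 + S) = S`. -/
theorem expNegPowReturn_eq_half_iff (h : IsUniformStepPair P M ξ η) (hM : 1 ≤ M) {x : ℝ}
    (hx : 1 < x) : expNegPowReturn P ξ η x = 1 / 2 ↔
      HasSum (fun n => meetProb M (n + 1) * x⁻¹ ^ (n + 1)) 1 := by
  have hxi : 0 < x⁻¹ := inv_pos.2 (by linarith)
  have hF := h.hasSum_expNegPowReturn hx
  have hs1 := summable_shift_mul_pow (meetProb_nonneg M) (meetProb_le_one hM) hxi.le
    (inv_lt_one_of_one_lt₀ hx)
  have hs : Summable fun n => meetProb M n * x⁻¹ ^ n := (summable_nat_add_iff 1).1 hs1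
  have hprod := tsum_mul_tsum_eq_tsum_sum_range_of_summable_norm hF.summable.norm hs.norm
  have hterm : ∀ n, ∑ k ∈ Finset.range (n + 1),
      (∫ ω, firstReturnInd (diffStep ξ η ω) k ∂P) * x⁻¹ ^ (k + 1)
        * (meetProb M (n - k) * x⁻¹ ^ (n - k)) = meetProb M (n + 1) * x⁻¹ ^ (n + 1) := by
    intro n
    rw [h.meetProb_succ_eq, Finset.sum_mul]
    refine Finset.sum_congr rfl fun k hk => ?_
    have hk := Finset.mem_range.1 hk
    rw [show n + 1 = (k + 1) + (n - k) by omega, pow_add x⁻¹ (k + 1) (n - k)]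
    ring
  simp_rw [hterm] at hprod
  have h0 := hs.tsum_eq_zero_add
  rw [meetProb_zero, pow_zero, mul_one] at h0
  rw [hF.tsum_eq, h0] at hprod
  have hpos : 0 ≤ ∑' n, meetProb M (n + 1) * x⁻¹ ^ (n + 1) :=
    tsum_nonneg fun n => mul_nonneg (meetProb_nonneg M _) (by positivity)
  rw [hs1.hasSum_iff]
  constructor
  · intro hE
    rw [hE] at hprod
    linarith
  · intro hE
    rw [hE] at hprod
    linarith

end IsUniformStepPair

theorem mainTheorem7 (M : ℕ) (hM : 1 ≤ M) :
    ∃ c C : ℝ, 1 < c ∧ 0 < C ∧ (M = 2 → c = 4 / 3) ∧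
      ∀ (Ω : Type*) [MeasurableSpace Ω] (P : Measure Ω) [IsProbabilityMeasure P]
        (ξ η : ℕ → Ω → ℤ), IsUniformStepPair P M ξ η →
        (∀ x : ℝ, 1 < x → (expNegPowReturn P ξ η x = 1 / 2 ↔ x = c)) ∧
        (fun n : ℕ => expTwoPowVisits P ξ η n) ~[atTop] (fun n : ℕ => C * c ^ n) ∧
        Monotone (fun n : ℕ => expTwoPowVisits P ξ η n / c ^ n) ∧
        (∀ n : ℕ, expTwoPowVisits P ξ η n * expTwoPowVisits P ξ η (n + 2)
          ≤ expTwoPowVisits P ξ η (n + 1) ^ 2) := by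
  have hu := meetProb_nonneg M
  have hanti := antitone_meetProb hM
  -- Both constants come from `meetProb M` alone, hence are independent of the probability space.
  obtain ⟨c, hc, hsum⟩ := exists_hasSum_shift_mul_pow hu (meetProb_le_one hM)
    (not_summable_meetProb hM)
  have huniq : ∀ x : ℝ, 1 < x → HasSum (fun n => meetProb M (n + 1) * x⁻¹ ^ (n + 1)) 1 → x = c :=
    fun x hx hsx => inv_injective (hasSum_shift_mul_pow_unique hu (meetProb_pos hM 1)
      (inv_nonneg.2 (by linarith)) (inv_nonneg.2 (by linarith)) hsx hsum)
  obtain ⟨C, hC, hequiv⟩ := exists_tendsto_renewalSeq_div_pow hu hanti hc hsum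
  refine ⟨c, C, hc, hC, ?_, ?_⟩
  · rintro rfl
    exact (huniq (4 / 3) (by norm_num) hasSum_meetProb_two).symm
  · intro Ω _ P _ ξ η h
    rw [h.expTwoPowVisits_eq]
    refine ⟨fun x hx => ?_, hequiv, monotone_renewalSeq_div_pow hu hanti hc hsum,
      renewalSeq_log_concave hu hanti⟩
    rw [h.expNegPowReturn_eq_half_iff hM hx]
    exact ⟨huniq x hx, fun hxc => hxc ▸ hsum⟩
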